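/- Let $\mathbb N=\{1,2,\dots\}$ and $\mathbb N_0=\mathbb N\cup\{0\}$. Let $\alpha=(\alpha_n)_{n\in\mathbb N_0}$ be a non-negative increasing (i.e. non-decreasing) sequence of real numbers such that $\lim_{n\to\infty}\alpha_n=\infty$, the limit $l:=\lim_{n\to\infty}(\alpha_{n+1}-\alpha_n)$ exists in $[0,\infty)$, and, for some $c>0$, $\alpha_n\ge c\log(n+1)$ for all $n\in\mathbb N_0$. Let $\Lambda_\infty(\alpha)$ be the power series space of infinite type $$\Lambda_\infty(\alpha)=\Big\{x=(x_n)_{n\in\mathbb N_0}\in\mathbb C^{\mathbb N_0}:\ |x|_k^2:=\sum_{n=0}^\infty|x_n|^2e^{2k\alpha_n}<\infty\ \text{ for all } k\in\mathbb N\Big\},$$ endowed with the locally convex topology generated by the norms $|\cdot|_k$, $k\in\mathbb N$. For real $r,s\neq0$ let $B(r,s)$ be the operator $B(r,s)x=(s\,x_{n-1}+r\,x_n)_{n\in\mathbb N_0}$, where $x_{-1}:=0$. For a continuous linear operator $T$ on a locally convex Hausdorff space $X$ over $\mathbb C$, let $\rho(T)$ be the set of $\lambda\in\mathbb C$ for which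 $T-\lambda I$ has an inverse $R(\lambda,T)$ that is a continuous linear operator on $X$, and let $\sigma(T)=\mathbb C\setminus\rho(T)$ be the spectrum. The Waelbroeck spectrum $\sigma^*(T)$ is the complement of the set of all $\lambda\in\mathbb C$ for which there is $\delta>0$ such that the open disc $\{\mu:|\mu-\lambda|<\delta\}$ is contained in $\rho(T)$ and $\{R(\mu,T):|\mu-\lambda|<\delta\}$ is equicontinuous. The point spectrum $\sigma_p(T)$ is the set of $\lambda$ with $\ker(T-\lambda I)\ne\{0\}$; the continuous spectrum $\sigma_c(T)$ is the set of $\lambda$ for which $T-\lambda I$ is injective and not surjective and has dense range; the residual spectrum $\sigma_r(T)$ is the set of $\lambda$ for which $T-\lambda I$ is injective and its range is not dense. Then, for all real $r,s\ne0$, $B(r,s)$ maps $\Lambda_\infty(\alpha)$ into itself and is a continuous linear operator on $\Lambda_\infty(\alpha)$, and for its spectra on $\Lambda_\infty(\alpha)$ the following hold. (1) If $l=0$, then $\sigma_p(B(r,s))=\sigma_c(B(r,s))=\emptyset$ and $$\sigma^*(B(r,s))=\sigma(B(r,s))=\sigma_r(B(r,s))=\{\lambda\in\mathbb C:|\lambda-r|\le|s|\}.$$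 (2) If $l>0$, then $\sigma_p(B(r,s))=\sigma_c(B(r,s))=\emptyset$ and $$\sigma^*(B(r,s))=\sigma(B(r,s))=\sigma_r(B(r,s))=\mathbb C.$$ -/

import Mathlib

noncomputable section

/-- The generalized difference operator `B(r,s)` on the space `ω = ℕ → ℂ` of all complex sequences:
`(B(r,s) x)ₙ = s xₙ₋₁ + r xₙ` with the convention `x₋₁ = 0`. -/
def differenceOp (r s : ℝ) : (ℕ → ℂ) →ₗ[ℂ] (ℕ → ℂ) where
  toFun x n := (s : ℂ) * (if n = 0 then 0 else x (n - 1)) + (r : ℂ) * x n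
  map_add' x y := by
    funext n
    by_cases hn : n = 0 <;> simp [hn] <;> ring
  map_smul' c x := by
    funext n
    by_cases hn : n = 0 <;> simp [hn] <;> ring

namespace PowerSeriesSpace

/-- The `n`-th term of the series that defines `|x|_k ^ 2`. -/
def term (α : ℕ → ℝ) (k : ℕ+) (x : ℕ → ℂ) (n : ℕ) : ℝ :=
  ‖x n‖ ^ 2 * Real.exp (2 * (k : ℕ) * α n)

theorem term_nonneg (α : ℕ → ℝ) (k : ℕ+) (x : ℕ → ℂ) (n : ℕ) : 0 ≤ term α k x n := by
  unfold term
  positivity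

theorem term_eq (α : ℕ → ℝ) (k : ℕ+) (x : ℕ → ℂ) (n : ℕ) :
    term α k x n = (‖x n‖ * Real.exp ((k : ℕ) * α n)) ^ (2 : ℝ) := by
  rw [Real.rpow_two, mul_pow, ← Real.exp_nat_mul, term]
  congr 2
  push_cast
  ring

theorem term_smul (α : ℕ → ℝ) (k : ℕ+) (c : ℂ) (x : ℕ → ℂ) :
    term α k (c • x) = fun n => ‖c‖ ^ 2 * term α k x n := by
  funext n
  simp [term, mul_pow, mul_assoc]

theorem term_add_le (α : ℕ → ℝ) (k : ℕ+) (x y : ℕ → ℂ) (n : ℕ) :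
    term α k (x + y) n ≤
      (‖x n‖ * Real.exp ((k : ℕ) * α n) + ‖y n‖ * Real.exp ((k : ℕ) * α n)) ^ (2 : ℝ) := by
  rw [term_eq, ← add_mul]
  gcongr
  exact norm_add_le (x n) (y n)

theorem minkowski (α : ℕ → ℝ) (k : ℕ+) {x y : ℕ → ℂ} (hx : Summable (term α k x))
    (hy : Summable (term α k y)) :
    Summable (term α k (x + y)) ∧
      √(∑' n, term α k (x + y) n) ≤ √(∑' n, term α k x n) + √(∑' n, term α k y n) := by
  obtain ⟨h1, h2⟩ := Real.Lp_add_le_tsum_of_nonneg (p := 2) one_le_two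
    (f := fun n => ‖x n‖ * Real.exp ((k : ℕ) * α n))
    (g := fun n => ‖y n‖ * Real.exp ((k : ℕ) * α n))
    (fun n => by positivity) (fun n => by positivity)
    (by simpa only [← term_eq] using hx) (by simpa only [← term_eq] using hy)
  have h3 : Summable (term α k (x + y)) :=
    Summable.of_nonneg_of_le (term_nonneg α k _) (term_add_le α k x y) h1
  refine ⟨h3, ?_⟩
  simp only [← term_eq, ← Real.sqrt_eq_rpow] at h2
  exact (Real.sqrt_le_sqrt (h3.tsum_le_tsum (term_add_le α k x y) h1)).trans h2

/-- The sequences `x` with `∑ₙ |xₙ|² e^{2 k αₙ} < ∞` for every `k ∈ {1, 2, …}`. -/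
def sequences (α : ℕ → ℝ) : Submodule ℂ (ℕ → ℂ) where
  carrier := {x | ∀ k : ℕ+, Summable fun n => ‖x n‖ ^ 2 * Real.exp (2 * (k : ℕ) * α n)}
  zero_mem' k := by simp [summable_zero]
  add_mem' hx hy k := (minkowski α k (hx k) (hy k)).1
  smul_mem' c x hx k := by
    have h : Summable (term α k (c • x)) := by
      rw [term_smul]
      exact Summable.mul_left _ (hx k)
    exact h

end PowerSeriesSpace

/-- The power series space `Λ_∞(α)` of infinite type. It is a type of its own, not a subtype of
`ℕ → ℂ`, because its topology is finer than that of coordinatewise convergence. -/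
def PowerSeriesSpace (α : ℕ → ℝ) : Type := PowerSeriesSpace.sequences α

namespace PowerSeriesSpace

instance (α : ℕ → ℝ) : AddCommGroup (PowerSeriesSpace α) :=
  inferInstanceAs (AddCommGroup (sequences α))

instance (α : ℕ → ℝ) : Module ℂ (PowerSeriesSpace α) :=
  inferInstanceAs (Module ℂ (sequences α))

/-- The inclusion of `Λ_∞(α)` into the space of all sequences. -/
def toSeq (α : ℕ → ℝ) : PowerSeriesSpace α →ₗ[ℂ] (ℕ → ℂ) := (sequences α).subtype

/-- The norms `|x|_k = (∑ₙ |xₙ|² e^{2 k αₙ})^{1/2}`, `k ∈ {1, 2, …}`, on `Λ_∞(α)`. -/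
def seminorms (α : ℕ → ℝ) : SeminormFamily ℂ (PowerSeriesSpace α) ℕ+ := fun k =>
  Seminorm.of
    (fun x => √(∑' n, ‖toSeq α x n‖ ^ 2 * Real.exp (2 * (k : ℕ) * α n)))
    (fun x y => (minkowski α k (x.2 k) (y.2 k)).2)
    (fun c x => by
      have h : √(∑' n, term α k (c • toSeq α x) n) = ‖c‖ * √(∑' n, term α k (toSeq α x) n) := by
        rw [term_smul, tsum_mul_left, Real.sqrt_mul (sq_nonneg _), Real.sqrt_sq (norm_nonneg _)]
      exact h)

/-- The uniform structure, and with it the locally convex topology, generated by the norms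
`|·|_k`. -/
instance (α : ℕ → ℝ) : UniformSpace (PowerSeriesSpace α) :=
  ⨅ k : ℕ+, (seminorms α k).toSeminormedAddCommGroup.toUniformSpace

instance (α : ℕ → ℝ) : IsUniformAddGroup (PowerSeriesSpace α) :=
  isUniformAddGroup_iInf fun k =>
    (seminorms α k).toSeminormedAddCommGroup.to_isUniformAddGroup

theorem withSeminorms (α : ℕ → ℝ) : WithSeminorms (seminorms α) :=
  (SeminormFamily.withSeminorms_iff_uniformSpace_eq_iInf (seminorms α)).2 rfl

instance (α : ℕ → ℝ) : ContinuousSMul ℂ (PowerSeriesSpace α) :=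
  (withSeminorms α).continuousSMul

end PowerSeriesSpace

section Spectra

variable {X : Type*} [AddCommGroup X] [Module ℂ X] [UniformSpace X] [IsUniformAddGroup X]
  [ContinuousSMul ℂ X]

/-- The point spectrum: `Ker (T - λ I) ≠ {0}`. -/
def pointSpectrum (T : X →L[ℂ] X) : Set ℂ :=
  {z | ∃ x : X, (T - z • ContinuousLinearMap.id ℂ X) x = 0 ∧ x ≠ 0}

/-- The continuous spectrum: `T - λ I` is injective and not surjective, with dense range. -/
def continuousSpectrum (T : X →L[ℂ] X) : Set ℂ :=
  {z | (∀ x : X, (T - z • ContinuousLinearMap.id ℂ X) x = 0 → x = 0) ∧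
    Set.range (T - z • ContinuousLinearMap.id ℂ X) ≠ Set.univ ∧
    closure (Set.range (T - z • ContinuousLinearMap.id ℂ X)) = Set.univ}

/-- The residual spectrum: `T - λ I` is injective and its range is not dense. -/
def residualSpectrum (T : X →L[ℂ] X) : Set ℂ :=
  {z | (∀ x : X, (T - z • ContinuousLinearMap.id ℂ X) x = 0 → x = 0) ∧
    closure (Set.range (T - z • ContinuousLinearMap.id ℂ X)) ≠ Set.univ}

/-- The Waelbroeck spectrum: the complement of the set of all `z` with an open disc around `z` in
the resolvent set on which the resolvents `(μ I - T)⁻¹` form an equicontinuous family. (Taking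
`(T - μ I)⁻¹` instead only changes the sign, which does not affect equicontinuity.) -/
def waelbroeckSpectrum (T : X →L[ℂ] X) : Set ℂ :=
  {z | ∃ δ : ℝ, 0 < δ ∧ Metric.ball z δ ⊆ resolventSet ℂ T ∧
    Equicontinuous fun μ : Metric.ball z δ => ⇑(resolvent T (μ : ℂ) : X →L[ℂ] X)}ᶜ

end Spectra

end

/-! Everything is squeezed between the residual and the Waelbroeck spectrum, since
`residualSpectrum` ⊆ `spectrum` ⊆ `waelbroeckSpectrum`. As s ≠ 0, B - z is always injective. Lower
bound: with q = (z - r)/s, the functional f(x) = ∑ xₙ qⁿ formally satisfies f((B - z)x) = (sq + r -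
z) f(x) = 0, and f(e₀) = 1. So the range is not dense once f is continuous, that is, once qⁿ
e^{-kαₙ} is square summable for some k. For |q| ≤ 1 the logarithmic growth of α ensures this; for l
> 0, α grows linearly and every q is allowed (`closure_range_sub_smul_ne_univ`). Upper bound for l =
0: if |r - z| ≥ R > |s|, solving (B - z)x = y forwards multiplies the weighted entries by at most
(|s|/R) e^{k(αₙ₊₁ - αₙ)}, which tends to |s|/R < 1. This bounds the resolvents in each norm,
uniformly in such z (`exists_resolvent_bound`). -/

open Filter Topology

namespace PowerSeriesSpace

/-- A nonnegative sequence satisfying `aₙ₊₁ ≤ bₙ₊₁ + ρ aₙ` with `ρ < 1` is square summable as soon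
as `b` is, with a corresponding bound on the sums of squares. -/
theorem summable_sq_of_le_add_mul {a b : ℕ → ℝ} {ρ : ℝ} (ha : ∀ n, 0 ≤ a n)
    (hρ : 0 ≤ ρ) (hρ1 : ρ < 1) (h0 : a 0 ≤ b 0) (h : ∀ n, a (n + 1) ≤ b (n + 1) + ρ * a n)
    (hs : Summable fun n => b n ^ 2) :
    Summable (fun n => a n ^ 2) ∧
      ∑' n, a n ^ 2 ≤ (1 - ρ)⁻¹ ^ 2 * ∑' n, b n ^ 2 := by
  have hpos : 0 < 1 - ρ := by linarith
  have hinv : 1 ≤ (1 - ρ)⁻¹ := (one_le_inv₀ hpos).2 (by linarith)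
  have hcancel : (1 - ρ) * (1 - ρ)⁻¹ = 1 := mul_inv_cancel₀ hpos.ne'
  -- Convexity of the square, with weights 1 - ρ and ρ at the points b/(1 - ρ) and a.
  have step (n : ℕ) : a (n + 1) ^ 2 ≤ (1 - ρ)⁻¹ * b (n + 1) ^ 2 + ρ * a n ^ 2 := by
    have h1 : a (n + 1) ^ 2 ≤ (b (n + 1) + ρ * a n) ^ 2 := pow_le_pow_left₀ (ha _) (h n) 2
    have h2 : (1 - ρ)⁻¹ * b (n + 1) ^ 2 + ρ * a n ^ 2 - (b (n + 1) + ρ * a n) ^ 2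
        = ρ * (1 - ρ) * ((1 - ρ)⁻¹ * b (n + 1) - a n) ^ 2 := by
      field_simp
      ring
    have h3 : 0 ≤ ρ * (1 - ρ) * ((1 - ρ)⁻¹ * b (n + 1) - a n) ^ 2 := by positivity
    linarith
  have partial_le (M : ℕ) : ∑ n ∈ Finset.range (M + 1), a n ^ 2 ≤
      (1 - ρ)⁻¹ * ∑ n ∈ Finset.range (M + 1), b n ^ 2
        + ρ * ∑ n ∈ Finset.range M, a n ^ 2 := by
    rw [Finset.sum_range_succ' _ M, Finset.sum_range_succ' _ M, mul_add, Finset.mul_sum,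
      Finset.mul_sum]
    have h1 := Finset.sum_le_sum fun n (_ : n ∈ Finset.range M) => step n
    rw [Finset.sum_add_distrib] at h1
    have h2 : a 0 ^ 2 ≤ b 0 ^ 2 := pow_le_pow_left₀ (ha _) h0 2
    have h3 : b 0 ^ 2 ≤ (1 - ρ)⁻¹ * b 0 ^ 2 := le_mul_of_one_le_left (sq_nonneg _) hinv
    linarith
  have bound (M : ℕ) : ∑ n ∈ Finset.range M, a n ^ 2 ≤ (1 - ρ)⁻¹ ^ 2 * ∑' n, b n ^ 2 := by
    have h1 : ∑ n ∈ Finset.range M, a n ^ 2 ≤ ∑ n ∈ Finset.range (M + 1), a n ^ 2 := by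
      rw [Finset.sum_range_succ]
      linarith [sq_nonneg (a M)]
    have h2 : ∑ n ∈ Finset.range (M + 1), b n ^ 2 ≤ ∑' n, b n ^ 2 :=
      hs.sum_le_tsum _ fun _ _ => sq_nonneg _
    -- The sum of a² can be absorbed on the left because it is still finite.
    have h3 : (1 - ρ) * ∑ n ∈ Finset.range M, a n ^ 2 ≤ (1 - ρ)⁻¹ * ∑' n, b n ^ 2 := by
      have := mul_le_mul_of_nonneg_left h2 (zero_le_one.trans hinv)
      linarith [partial_le M]
    have h4 := mul_le_mul_of_nonneg_left h3 (zero_le_one.trans hinv)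
    rw [← mul_assoc, inv_mul_cancel₀ hpos.ne', one_mul] at h4
    linarith
  exact ⟨summable_of_sum_range_le (fun _ => sq_nonneg _) bound,
    Real.tsum_le_of_sum_range_le (fun _ => sq_nonneg _) bound⟩

/-! ### Continuity of B(r,s) on Λ_∞(α). -/

variable {α : ℕ → ℝ}

theorem toSeq_injective : Function.Injective (toSeq α) := Subtype.val_injective

theorem summable_term (k : ℕ+) (x : PowerSeriesSpace α) : Summable (term α k (toSeq α x)) := x.2 k

theorem exists_toSeq_eq {x : ℕ → ℂ} (hx : ∀ k, Summable (term α k x)) :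
    ∃ y : PowerSeriesSpace α, toSeq α y = x := ⟨⟨x, hx⟩, rfl⟩

theorem seminorms_apply (k : ℕ+) (x : PowerSeriesSpace α) :
    seminorms α k x = √(∑' n, term α k (toSeq α x) n) := rfl

theorem seminorms_le_sqrt_mul {k : ℕ+} {x y : PowerSeriesSpace α} {C : ℝ} (hC : 0 ≤ C)
    (h : ∑' n, term α k (toSeq α x) n ≤ C * ∑' n, term α k (toSeq α y) n) :
    seminorms α k x ≤ √C * seminorms α k y := by
  rw [seminorms_apply, seminorms_apply, ← Real.sqrt_mul hC]
  exact Real.sqrt_le_sqrt h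

theorem continuous_of_seminorms_le (f : PowerSeriesSpace α →ₗ[ℂ] PowerSeriesSpace α)
    (h : ∀ k, ∃ C : ℝ, 0 ≤ C ∧ ∀ x, seminorms α k (f x) ≤ C * seminorms α k x) :
    Continuous f := by
  refine WithSeminorms.continuous_of_isBounded (withSeminorms α) (withSeminorms α) f fun k => ?_
  obtain ⟨C, hC, hf⟩ := h k
  refine ⟨{k}, ⟨C, hC⟩, fun x => ?_⟩
  simpa using! hf x

/-- A shift by one index costs at most the factor e^{2kD} in the weight, so no loss in k occurs. -/
theorem term_differenceOp_bound (r s : ℝ) {D : ℝ} (hD : ∀ n, α (n + 1) - α n ≤ D) (k : ℕ+)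
    {x : ℕ → ℂ} (hx : Summable (term α k x)) :
    Summable (term α k (differenceOp r s x)) ∧
      ∑' n, term α k (differenceOp r s x) n ≤
        (2 * r ^ 2 + 2 * s ^ 2 * Real.exp (2 * (k : ℕ) * D)) * ∑' n, term α k x n := by
  set g : ℕ → ℝ := fun n => if n = 0 then 0 else term α k x (n - 1) with hg
  set E := Real.exp (2 * (k : ℕ) * D) with hE
  have hgs : Summable g := (summable_nat_add_iff 1).1 (by simpa [hg] using hx)
  have hgt : ∑' n, g n = ∑' n, term α k x n := by
    rw [hgs.tsum_eq_zero_add]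
    simp [hg]
  have le (n : ℕ) : term α k (differenceOp r s x) n ≤
      2 * r ^ 2 * term α k x n + 2 * s ^ 2 * E * g n := by
    have key (u v : ℂ) : ‖(s : ℂ) * u + (r : ℂ) * v‖ ^ 2 ≤
        2 * r ^ 2 * ‖v‖ ^ 2 + 2 * s ^ 2 * ‖u‖ ^ 2 := by
      have h1 : ‖(s : ℂ) * u + (r : ℂ) * v‖ ≤ |s| * ‖u‖ + |r| * ‖v‖ := by
        simpa using norm_add_le ((s : ℂ) * u) ((r : ℂ) * v)
      have h2 := pow_le_pow_left₀ (norm_nonneg _) h1 2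
      have h3 := sq_nonneg (|s| * ‖u‖ - |r| * ‖v‖)
      rw [← sq_abs r, ← sq_abs s]
      nlinarith
    rcases n with _ | n
    · have := mul_le_mul_of_nonneg_right (key 0 (x 0)) (Real.exp_pos (2 * (k : ℕ) * α 0)).le
      simp only [term, differenceOp, LinearMap.coe_mk, AddHom.coe_mk, hg, if_true]
      simp only [norm_zero] at this
      linarith
    · have h1 := mul_le_mul_of_nonneg_right (key (x n) (x (n + 1)))
        (Real.exp_pos (2 * (k : ℕ) * α (n + 1))).le
      have h2 : Real.exp (2 * (k : ℕ) * α (n + 1)) ≤ E * Real.exp (2 * (k : ℕ) * α n) := by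
        rw [hE, ← Real.exp_add, ← mul_add]
        exact Real.exp_le_exp.2 (mul_le_mul_of_nonneg_left (by linarith [hD n]) (by positivity))
      have h3 := mul_le_mul_of_nonneg_left h2
        (show 0 ≤ 2 * s ^ 2 * ‖x n‖ ^ 2 by positivity)
      simp only [term, differenceOp, LinearMap.coe_mk, AddHom.coe_mk, hg, Nat.add_eq_zero_iff,
        one_ne_zero, and_false, if_false, Nat.add_sub_cancel]
      linarith
  have hsum : Summable fun n => 2 * r ^ 2 * term α k x n + 2 * s ^ 2 * E * g n :=
    (hx.mul_left _).add (hgs.mul_left _)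
  have h1 : Summable (term α k (differenceOp r s x)) :=
    Summable.of_nonneg_of_le (term_nonneg α k _) le hsum
  refine ⟨h1, (h1.tsum_le_tsum le hsum).trans_eq ?_⟩
  rw [(hx.mul_left _).tsum_add (hgs.mul_left _), tsum_mul_left, tsum_mul_left, hgt]
  ring

theorem exists_continuousLinearMap_differenceOp (r s : ℝ) {D : ℝ}
    (hD : ∀ n, α (n + 1) - α n ≤ D) :
    ∃ B : PowerSeriesSpace α →L[ℂ] PowerSeriesSpace α,
      ∀ x, toSeq α (B x) = differenceOp r s (toSeq α x) := by
  choose f hf using fun x : PowerSeriesSpace α => exists_toSeq_eq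
    fun k => (term_differenceOp_bound r s hD k (summable_term k x)).1
  let F : PowerSeriesSpace α →ₗ[ℂ] PowerSeriesSpace α :=
    { toFun := f
      map_add' := fun x y => toSeq_injective (by simp [hf])
      map_smul' := fun c x => toSeq_injective (by simp [hf]) }
  refine ⟨⟨F, continuous_of_seminorms_le F fun k =>
    ⟨√(2 * r ^ 2 + 2 * s ^ 2 * Real.exp (2 * (k : ℕ) * D)), Real.sqrt_nonneg _, fun x =>
      seminorms_le_sqrt_mul (by positivity) ?_⟩⟩, hf⟩
  change ∑' n, term α k (toSeq α (f x)) n ≤ _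
  rw [hf]
  exact (term_differenceOp_bound r s hD k (summable_term k x)).2

/-! ### The functionals x ↦ ∑ xₙ qⁿ. -/

theorem exists_summable_sq_pow_mul_exp_neg {l : ℝ}
    (hα_diff : Tendsto (fun n => α (n + 1) - α n) atTop (𝓝 l))
    (hα_log : ∃ c : ℝ, 0 < c ∧ ∀ n : ℕ, c * Real.log ((n : ℝ) + 1) ≤ α n)
    {Q : ℝ} (hQ : 0 ≤ Q) (h : Q ≤ 1 ∨ 0 < l) :
    ∃ k : ℕ+, Summable fun n => (Q ^ n * Real.exp (-((k : ℕ) * α n))) ^ 2 := by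
  rcases le_or_gt Q 1 with hQ1 | hQ1
  · obtain ⟨c, hc, hlog⟩ := hα_log
    -- With mc > 1 the weight e^{-(m+1)αₙ} is at most 1/(n+1); using m + 1 keeps the index positive.
    obtain ⟨m, hm⟩ := exists_nat_gt (1 / c)
    have hmc : 1 < m * c := (div_lt_iff₀ hc).1 hm
    refine ⟨⟨m + 1, m.succ_pos⟩, Summable.of_nonneg_of_le (fun _ => sq_nonneg _) (fun n => ?_)
      ((summable_nat_add_iff 1).2 (Real.summable_nat_pow_inv.2 one_lt_two))⟩
    rw [← inv_pow]
    refine pow_le_pow_left₀ (by positivity) ?_ 2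
    have h1 : Real.exp (-(((m + 1 : ℕ) : ℝ) * α n)) ≤ ((n + 1 : ℕ) : ℝ)⁻¹ := by
      have hpos : (0 : ℝ) < n + 1 := by positivity
      have hlog0 : 0 ≤ Real.log ((n : ℝ) + 1) := Real.log_nonneg (by linarith [n.cast_nonneg (α := ℝ)])
      have h2 : Real.log ((n : ℝ) + 1) ≤ ((m + 1 : ℕ) : ℝ) * α n := by
        have := mul_le_mul_of_nonneg_left (hlog n) (show (0 : ℝ) ≤ m + 1 by positivity)
        push_cast
        nlinarith
      push_cast at h2 ⊢
      rw [Real.exp_neg]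
      refine inv_anti₀ hpos ?_
      calc (n : ℝ) + 1 = Real.exp (Real.log (n + 1)) := (Real.exp_log hpos).symm
        _ ≤ _ := Real.exp_le_exp.2 h2
    calc Q ^ n * Real.exp (-(((m + 1 : ℕ) : ℝ) * α n)) ≤ 1 * ((n + 1 : ℕ) : ℝ)⁻¹ :=
          mul_le_mul (pow_le_one₀ hQ hQ1) h1 (Real.exp_pos _).le zero_le_one
      _ = _ := one_mul _
  · have hlpos : 0 < l := h.resolve_left hQ1.not_ge
    have hQ0 : 0 < Q := one_pos.trans hQ1
    -- Chosen so that the limiting ratio (Q e^{-(m+1)l})² is below 1.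
    obtain ⟨m, hm⟩ := exists_nat_gt (Real.log Q / l)
    have hml : Real.log Q < m * l := (div_lt_iff₀ hlpos).1 hm
    have hk : (Q * Real.exp (-(((m + 1 : ℕ) : ℝ) * l))) ^ 2 < 1 := by
      refine pow_lt_one₀ (by positivity) ?_ two_ne_zero
      nth_rewrite 1 [← Real.exp_log hQ0]
      rw [← Real.exp_add, Real.exp_lt_one_iff]
      push_cast
      linarith
    refine ⟨⟨m + 1, m.succ_pos⟩, summable_of_ratio_test_tendsto_lt_one hk
      (Eventually.of_forall fun n => by positivity) ?_⟩
    have ht : Tendsto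
        (fun n => (Q * Real.exp (-(((m + 1 : ℕ) : ℝ) * (α (n + 1) - α n)))) ^ 2) atTop
        (𝓝 ((Q * Real.exp (-(((m + 1 : ℕ) : ℝ) * l))) ^ 2)) :=
      (((Real.continuous_exp.tendsto _).comp (hα_diff.const_mul _).neg).const_mul Q).pow 2
    refine ht.congr fun n => ?_
    have e : Real.exp (-(((m + 1 : ℕ) : ℝ) * (α (n + 1) - α n))) =
        Real.exp (-(((m + 1 : ℕ) : ℝ) * α (n + 1))) / Real.exp (-(((m + 1 : ℕ) : ℝ) * α n)) := by
      rw [← Real.exp_sub]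
      congr 1
      ring
    rw [Real.norm_of_nonneg (sq_nonneg _), Real.norm_of_nonneg (sq_nonneg _), e, PNat.mk_coe,
      ← div_pow]
    congr 1
    field_simp
    ring

/-- Cauchy–Schwarz, after splitting 1 = e^{kαₙ} e^{-kαₙ}. -/
theorem summable_mul_pow {q : ℂ} {k : ℕ+}
    (hk : Summable fun n => (‖q‖ ^ n * Real.exp (-((k : ℕ) * α n))) ^ 2)
    (x : PowerSeriesSpace α) :
    Summable (fun n => toSeq α x n * q ^ n) ∧
      ‖∑' n, toSeq α x n * q ^ n‖ ≤
        √(∑' n, (‖q‖ ^ n * Real.exp (-((k : ℕ) * α n))) ^ 2) * seminorms α k x := by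
  have hx := summable_term k x
  have h := Real.summable_and_inner_le_Lp_mul_Lq_tsum_of_nonneg (p := 2) (q := 2)
    (Real.holderConjugate_iff.2 ⟨one_lt_two, by norm_num⟩)
    (f := fun n => ‖toSeq α x n‖ * Real.exp ((k : ℕ) * α n))
    (g := fun n => ‖q‖ ^ n * Real.exp (-((k : ℕ) * α n)))
    (fun n => by positivity) (fun n => by positivity)
    (by simpa only [← term_eq] using hx) (by simpa only [Real.rpow_two] using hk)
  have e (n : ℕ) : ‖toSeq α x n‖ * Real.exp ((k : ℕ) * α n) *
      (‖q‖ ^ n * Real.exp (-((k : ℕ) * α n))) = ‖toSeq α x n * q ^ n‖ := by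
    rw [norm_mul, norm_pow, mul_mul_mul_comm, ← Real.exp_add, add_neg_cancel, Real.exp_zero,
      mul_one]
  simp only [e, ← term_eq, ← Real.sqrt_eq_rpow] at h
  simp only [Real.rpow_two] at h
  refine ⟨h.1.of_norm, (norm_tsum_le_tsum_norm h.1).trans ?_⟩
  rw [mul_comm, seminorms_apply]
  exact h.2

/-- The continuous functional `x ↦ ∑ₙ xₙ qⁿ`. -/
theorem exists_functional_pow {q : ℂ} {k : ℕ+}
    (hk : Summable fun n => (‖q‖ ^ n * Real.exp (-((k : ℕ) * α n))) ^ 2) :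
    ∃ f : PowerSeriesSpace α →ₗ[ℂ] ℂ, Continuous f ∧
      ∀ x, HasSum (fun n => toSeq α x n * q ^ n) (f x) := by
  have hsum := fun x => (summable_mul_pow hk x).1
  let f : PowerSeriesSpace α →ₗ[ℂ] ℂ :=
    { toFun := fun x => ∑' n, toSeq α x n * q ^ n
      map_add' := fun x y => by
        rw [← (hsum x).tsum_add (hsum y)]
        simp [add_mul]
      map_smul' := fun c x => by
        rw [RingHom.id_apply, smul_eq_mul, ← tsum_mul_left]
        simp [mul_assoc] }
  refine ⟨f, WithSeminorms.continuous_normedSpace_rng ℂ (withSeminorms α) f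
    ⟨{k}, ⟨√(∑' n, (‖q‖ ^ n * Real.exp (-((k : ℕ) * α n))) ^ 2), Real.sqrt_nonneg _⟩,
      fun x => ?_⟩, fun x => (hsum x).hasSum⟩
  simpa using! (summable_mul_pow hk x).2

/-! ### Injectivity and non-dense range of B - z. -/

theorem toSeq_sub_smul_apply {r s : ℝ} {B : PowerSeriesSpace α →L[ℂ] PowerSeriesSpace α}
    (hB : ∀ x, toSeq α (B x) = differenceOp r s (toSeq α x)) (z : ℂ) (x : PowerSeriesSpace α)
    (n : ℕ) : toSeq α ((B - z • ContinuousLinearMap.id ℂ (PowerSeriesSpace α)) x) n =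
      (s : ℂ) * (if n = 0 then 0 else toSeq α x (n - 1)) + ((r : ℂ) - z) * toSeq α x n := by
  have : (B - z • ContinuousLinearMap.id ℂ (PowerSeriesSpace α)) x = B x - z • x := rfl
  rw [this, map_sub, map_smul, hB]
  simp only [differenceOp, LinearMap.coe_mk, AddHom.coe_mk, Pi.sub_apply, Pi.smul_apply,
    smul_eq_mul]
  ring

theorem eq_zero_of_sub_smul_eq_zero {r s : ℝ} (hs : s ≠ 0)
    {B : PowerSeriesSpace α →L[ℂ] PowerSeriesSpace α}
    (hB : ∀ x, toSeq α (B x) = differenceOp r s (toSeq α x)) (z : ℂ) (x : PowerSeriesSpace α)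
    (hx : (B - z • ContinuousLinearMap.id ℂ (PowerSeriesSpace α)) x = 0) : x = 0 := by
  have h (n : ℕ) := toSeq_sub_smul_apply hB z x n
  simp only [hx, map_zero, Pi.zero_apply] at h
  apply toSeq_injective
  rw [map_zero]
  funext n
  rw [Pi.zero_apply]
  -- For z = r the operator is s times the right shift, so xₙ is read off at index n + 1; otherwise
  -- forward substitution applies.
  by_cases hz : (r : ℂ) - z = 0
  · simpa [hz, hs] using (h (n + 1)).symm
  · induction n with
    | zero => simpa [hz] using (h 0).symm
    | succ n ih => simpa [hz, ih] using (h (n + 1)).symm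

theorem closure_range_sub_smul_ne_univ {l : ℝ}
    (hα_diff : Tendsto (fun n => α (n + 1) - α n) atTop (𝓝 l))
    (hα_log : ∃ c : ℝ, 0 < c ∧ ∀ n : ℕ, c * Real.log ((n : ℝ) + 1) ≤ α n)
    {r s : ℝ} (hs : s ≠ 0) {B : PowerSeriesSpace α →L[ℂ] PowerSeriesSpace α}
    (hB : ∀ x, toSeq α (B x) = differenceOp r s (toSeq α x)) {z : ℂ}
    (hz : z ∈ Metric.closedBall (r : ℂ) |s| ∨ 0 < l) :
    closure (Set.range (B - z • ContinuousLinearMap.id ℂ (PowerSeriesSpace α))) ≠ Set.univ := by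
  set q : ℂ := (z - r) / s with hq
  have hsq : (s : ℂ) * q = z - r := mul_div_cancel₀ _ (Complex.ofReal_ne_zero.2 hs)
  have hq1 : ‖q‖ ≤ 1 ∨ 0 < l := hz.imp_left fun h => by
    rw [mem_closedBall_iff_norm] at h
    rw [hq, norm_div, Complex.norm_real, Real.norm_eq_abs]
    exact div_le_one_of_le₀ h (abs_nonneg s)
  obtain ⟨k, hk⟩ := exists_summable_sq_pow_mul_exp_neg hα_diff hα_log (norm_nonneg q) hq1
  obtain ⟨f, hf, hfs⟩ := exists_functional_pow hk
  have hker : Set.range (B - z • ContinuousLinearMap.id ℂ (PowerSeriesSpace α)) ⊆ f ⁻¹' {0} := by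
    rintro _ ⟨x, rfl⟩
    -- Shifting the sequence multiplies its generating sum by q.
    have h1 : HasSum (fun n => (if n = 0 then 0 else toSeq α x (n - 1)) * q ^ n) (q * f x) := by
      rw [← hasSum_nat_add_iff' 1]
      simpa [pow_succ', mul_left_comm] using (hfs x).mul_left q
    have h2 := (h1.mul_left (s : ℂ)).add ((hfs x).mul_left ((r : ℂ) - z))
    have e1 : (s : ℂ) * (q * f x) + ((r : ℂ) - z) * f x = 0 := by
      rw [← mul_assoc, hsq]
      ring
    rw [e1] at h2
    refine (hfs _).unique (Eq.mpr (congrArg (HasSum · (0 : ℂ)) (funext fun n => ?_)) h2)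
    rw [toSeq_sub_smul_apply hB]
    ring
  -- The unit vector e₀ lies outside the closed kernel of f.
  obtain ⟨e, he⟩ := exists_toSeq_eq (α := α) (x := Pi.single 0 1) fun k => by
    refine summable_of_ne_finset_zero (s := {0}) fun n hn => ?_
    have : n ≠ 0 := by simpa using hn
    simp [term, this]
  have hfe : f e = 1 := by
    refine (hfs e).unique ?_
    convert hasSum_single (α := ℂ) 0 _ using 1
    · simp [he]
    · intro n hn
      simp [he, hn]
  intro h
  have : e ∈ closure (Set.range (B - z • ContinuousLinearMap.id ℂ (PowerSeriesSpace α))) := h ▸ Set.mem_univ e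
  have := closure_minimal hker (isClosed_singleton.preimage hf) this
  simp [hfe] at this

/-! ### Resolvent estimates for l = 0. -/

/-- C is chosen before d: only the lower bound R for ‖d‖ enters, which later yields equicontinuity.
-/
theorem exists_term_bound_of_recursion (hα_nonneg : ∀ n, 0 ≤ α n) (hα_mono : Monotone α)
    (hα_diff : Tendsto (fun n => α (n + 1) - α n) atTop (𝓝 0)) {s R : ℝ} (hR : |s| < R)
    (k : ℕ+) :
    ∃ C : ℝ, 0 ≤ C ∧ ∀ (d : ℂ), R ≤ ‖d‖ → ∀ x y : ℕ → ℂ,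
      (∀ n, (s : ℂ) * (if n = 0 then 0 else x (n - 1)) + d * x n = y n) →
      Summable (term α k y) →
      Summable (term α k x) ∧ ∑' n, term α k x n ≤ C * ∑' n, term α k y n := by
  have hR0 : 0 < R := (abs_nonneg s).trans_lt hR
  have hρ0 : |s| / R < 1 := (div_lt_one hR0).2 hR
  obtain ⟨ρ, hρ, hρ1⟩ := exists_between hρ0
  have hρnn : 0 ≤ ρ := (div_nonneg (abs_nonneg s) hR0.le).trans hρ.le
  have ht : Tendsto (fun n => |s| / R * Real.exp ((k : ℕ) * (α (n + 1) - α n))) atTop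
      (𝓝 (|s| / R)) := by
    simpa using ((Real.continuous_exp.tendsto _).comp
      (hα_diff.const_mul ((k : ℕ) : ℝ))).const_mul (|s| / R)
  obtain ⟨N, hN⟩ := eventually_atTop.1 (ht.eventually_le_const hρ)
  -- The contraction by ρ is only known from N on. Freezing the weight below N makes it hold for all
  -- n, and changes the norm only to an equivalent one.
  set w : ℕ → ℝ := fun n => Real.exp ((k : ℕ) * α (max n N)) with hw
  have hw0 (n : ℕ) : 0 < w n := Real.exp_pos _
  have hwstep (n : ℕ) : |s| / R * w (n + 1) ≤ ρ * w n := by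
    rcases le_or_gt N n with h | h
    · have e : w (n + 1) = Real.exp ((k : ℕ) * (α (n + 1) - α n)) * w n := by
        simp only [hw, max_eq_left h, max_eq_left (h.trans n.le_succ)]
        rw [← Real.exp_add]
        congr 1
        ring
      rw [e, ← mul_assoc]
      exact mul_le_mul_of_nonneg_right (hN n h) (hw0 n).le
    · have e : w (n + 1) = w n := by
        simp only [hw, max_eq_right h.le, max_eq_right (Nat.succ_le_of_lt h)]
      rw [e]
      exact mul_le_mul_of_nonneg_right hρ.le (hw0 n).le
  have hwge (n : ℕ) : Real.exp ((k : ℕ) * α n) ≤ w n :=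
    Real.exp_le_exp.2 (mul_le_mul_of_nonneg_left (hα_mono (le_max_left _ _)) (by positivity))
  set K := Real.exp ((k : ℕ) * α N) / R with hK
  have hwle (n : ℕ) : w n / R ≤ K * Real.exp ((k : ℕ) * α n) := by
    rw [hK, div_mul_eq_mul_div]
    refine div_le_div_of_nonneg_right ?_ hR0.le
    rw [← Real.exp_add, ← mul_add]
    refine Real.exp_le_exp.2 (mul_le_mul_of_nonneg_left ?_ (by positivity))
    -- As α ≥ 0, the value of α at max n N is at most αₙ + α_N.
    rcases max_choice n N with h | h <;> rw [h] <;> linarith [hα_nonneg n, hα_nonneg N]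
  refine ⟨(1 - ρ)⁻¹ ^ 2 * K ^ 2, by positivity, fun d hd x y hxy hy => ?_⟩
  have hd0 : 0 < ‖d‖ := hR0.trans_le hd
  have norm_le (u v t : ℂ) (h : (s : ℂ) * u + d * v = t) : ‖v‖ ≤ ‖t‖ / R + |s| / R * ‖u‖ := by
    have h1 : d * v = t - s * u := by rw [← h]; ring
    have h2 : ‖d‖ * ‖v‖ ≤ ‖t‖ + |s| * ‖u‖ := by
      rw [← norm_mul, h1]
      simpa using norm_sub_le t (s * u)
    have h3 : R * ‖v‖ ≤ ‖d‖ * ‖v‖ := mul_le_mul_of_nonneg_right hd (norm_nonneg v)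
    rw [div_mul_eq_mul_div, ← add_div, le_div_iff₀ hR0]
    linarith
  have hbterm (n : ℕ) : (‖y n‖ * (w n / R)) ^ 2 ≤ K ^ 2 * term α k y n := by
    rw [term_eq, Real.rpow_two, ← mul_pow]
    refine pow_le_pow_left₀ (by positivity) ?_ 2
    have := mul_le_mul_of_nonneg_left (hwle n) (norm_nonneg (y n))
    linarith
  have haterm (n : ℕ) : term α k x n ≤ (‖x n‖ * w n) ^ 2 := by
    rw [term_eq, Real.rpow_two]
    exact pow_le_pow_left₀ (by positivity)
      (mul_le_mul_of_nonneg_left (hwge n) (norm_nonneg _)) 2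
  have hb : Summable fun n => (‖y n‖ * (w n / R)) ^ 2 :=
    Summable.of_nonneg_of_le (fun _ => sq_nonneg _) hbterm (hy.mul_left _)
  obtain ⟨ha, hle⟩ := summable_sq_of_le_add_mul (a := fun n => ‖x n‖ * w n)
    (b := fun n => ‖y n‖ * (w n / R)) (fun n => mul_nonneg (norm_nonneg _) (hw0 n).le)
    hρnn hρ1
    (by
      have h1 := mul_le_mul_of_nonneg_right (norm_le _ _ _ (hxy 0)) (hw0 0).le
      simp only [if_true, norm_zero, mul_zero, add_zero] at h1
      exact h1.trans_eq (by ring))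
    (fun n => by
      have h1 := mul_le_mul_of_nonneg_right (norm_le _ _ _ (hxy (n + 1))) (hw0 (n + 1)).le
      have h2 := mul_le_mul_of_nonneg_left (hwstep n) (norm_nonneg (x n))
      simp only [Nat.add_eq_zero_iff, one_ne_zero, and_false, if_false,
        Nat.add_sub_cancel] at h1
      calc _ ≤ _ := h1
        _ = ‖y (n + 1)‖ * (w (n + 1) / R) + ‖x n‖ * (|s| / R * w (n + 1)) := by ring
        _ ≤ _ := by linarith)
    hb
  have hx : Summable (term α k x) := Summable.of_nonneg_of_le (term_nonneg α k x) haterm ha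
  refine ⟨hx, ?_⟩
  calc ∑' n, term α k x n ≤ _ := hx.tsum_le_tsum haterm ha
    _ ≤ _ := hle
    _ ≤ (1 - ρ)⁻¹ ^ 2 * ∑' n, K ^ 2 * term α k y n :=
      mul_le_mul_of_nonneg_left (hb.tsum_le_tsum hbterm (hy.mul_left _)) (sq_nonneg _)
    _ = _ := by rw [tsum_mul_left, mul_assoc]

theorem exists_recursion (s : ℝ) {d : ℂ} (hd : d ≠ 0) (y : ℕ → ℂ) :
    ∃ x : ℕ → ℂ, ∀ n, (s : ℂ) * (if n = 0 then 0 else x (n - 1)) + d * x n = y n := by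
  refine ⟨fun n => Nat.rec (y 0 / d) (fun m u => (y (m + 1) - s * u) / d) n, fun n => ?_⟩
  rcases n with _ | n
  · simp [mul_div_cancel₀ _ hd]
  · simp [mul_div_cancel₀ _ hd]

theorem exists_resolvent_bound (hα_nonneg : ∀ n, 0 ≤ α n) (hα_mono : Monotone α)
    (hα_diff : Tendsto (fun n => α (n + 1) - α n) atTop (𝓝 0)) {r s R : ℝ} (hR : |s| < R)
    {B : PowerSeriesSpace α →L[ℂ] PowerSeriesSpace α}
    (hB : ∀ x, toSeq α (B x) = differenceOp r s (toSeq α x)) :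
    (∀ z : ℂ, R ≤ ‖(r : ℂ) - z‖ → z ∈ resolventSet ℂ B) ∧
      ∀ k, ∃ C : ℝ, 0 ≤ C ∧ ∀ z : ℂ, R ≤ ‖(r : ℂ) - z‖ → ∀ y,
        seminorms α k (resolvent B z y) ≤ C * seminorms α k y := by
  choose C hC0 hC using exists_term_bound_of_recursion hα_nonneg hα_mono hα_diff hR
  have bound (z : ℂ) (hz : R ≤ ‖(r : ℂ) - z‖) (k : ℕ+) (x : PowerSeriesSpace α) :
      seminorms α k x ≤ √(C k) * seminorms α k ((B - z • ContinuousLinearMap.id ℂ (PowerSeriesSpace α)) x) :=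
    seminorms_le_sqrt_mul (hC0 k) (hC k _ hz _ _
      (fun n => (toSeq_sub_smul_apply hB z x n).symm) (summable_term k _)).2
  -- `resolvent` inverts z - B rather than B - z; the sign is invisible to the seminorms.
  have hneg (z : ℂ) : algebraMap ℂ (PowerSeriesSpace α →L[ℂ] PowerSeriesSpace α) z - B =
      -(B - z • ContinuousLinearMap.id ℂ (PowerSeriesSpace α)) := by
    rw [neg_sub, Algebra.algebraMap_eq_smul_one]
    rfl
  have hunit (z : ℂ) (hz : R ≤ ‖(r : ℂ) - z‖) : z ∈ resolventSet ℂ B := by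
    have hd : (r : ℂ) - z ≠ 0 := norm_pos_iff.1 (((abs_nonneg s).trans_lt hR).trans_le hz)
    set T := B - z • ContinuousLinearMap.id ℂ (PowerSeriesSpace α) with hT
    have hsurj (y : PowerSeriesSpace α) : ∃ x, T x = y := by
      obtain ⟨u, hu⟩ := exists_recursion s hd (toSeq α y)
      obtain ⟨x, hx⟩ := exists_toSeq_eq
        fun k => (hC k _ hz u _ hu (summable_term k y)).1
      refine ⟨x, toSeq_injective (funext fun n => ?_)⟩
      rw [hT, toSeq_sub_smul_apply hB, hx, hu]
    have hinj : Function.Injective T := by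
      rw [injective_iff_map_eq_zero]
      intro x hx
      have h0 (n : ℕ) := toSeq_sub_smul_apply hB z x n
      rw [← hT, hx] at h0
      simp only [map_zero, Pi.zero_apply] at h0
      refine toSeq_injective (funext fun n => ?_)
      rw [map_zero, Pi.zero_apply]
      induction n with
      | zero => simpa [hd] using (h0 0).symm
      | succ n ih => simpa [hd, ih] using (h0 (n + 1)).symm
    let e := LinearEquiv.ofBijective (T : PowerSeriesSpace α →ₗ[ℂ] PowerSeriesSpace α)
      ⟨hinj, hsurj⟩
    have he (y : PowerSeriesSpace α) : T (e.symm y) = y := e.apply_symm_apply y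
    have hcont : Continuous (e.symm : PowerSeriesSpace α →ₗ[ℂ] PowerSeriesSpace α) :=
      continuous_of_seminorms_le _ fun k => ⟨_, Real.sqrt_nonneg _, fun y => by
        have := bound z hz k (e.symm y)
        rwa [← hT, he] at this⟩
    let S : PowerSeriesSpace α →L[ℂ] PowerSeriesSpace α := ⟨e.symm, hcont⟩
    have hTS : T * S = 1 := ContinuousLinearMap.ext he
    have hST : S * T = 1 := ContinuousLinearMap.ext fun x => e.symm_apply_apply x
    change IsUnit _
    rw [hneg]
    exact (IsUnit.neg_iff _).2 ⟨⟨T, S, hTS, hST⟩, rfl⟩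
  refine ⟨hunit, fun k => ⟨_, Real.sqrt_nonneg (C k), fun z hz y => ?_⟩⟩
  have h1 : (algebraMap ℂ (PowerSeriesSpace α →L[ℂ] PowerSeriesSpace α) z - B) *
      resolvent B z = 1 := Ring.mul_inverse_cancel _ (hunit z hz)
  have h2 : (B - z • ContinuousLinearMap.id ℂ (PowerSeriesSpace α)) (resolvent B z y) = -y := by
    rw [hneg, neg_mul] at h1
    have := congrArg (fun T : PowerSeriesSpace α →L[ℂ] PowerSeriesSpace α => -(T y)) h1
    simpa using! this
  have := bound z hz k (resolvent B z y)
  rwa [h2, map_neg_eq_map] at this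

theorem waelbroeckSpectrum_subset_closedBall (hα_nonneg : ∀ n, 0 ≤ α n) (hα_mono : Monotone α)
    (hα_diff : Tendsto (fun n => α (n + 1) - α n) atTop (𝓝 0)) {r s : ℝ}
    {B : PowerSeriesSpace α →L[ℂ] PowerSeriesSpace α}
    (hB : ∀ x, toSeq α (B x) = differenceOp r s (toSeq α x)) :
    waelbroeckSpectrum B ⊆ Metric.closedBall (r : ℂ) |s| := by
  intro z
  contrapose
  intro hz
  rw [mem_closedBall_iff_norm', not_le] at hz
  -- The ball of radius |r - z| - R about z stays in the region where the uniform bound holds.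
  obtain ⟨R, hR, hRz⟩ := exists_between hz
  have hball (μ : ℂ) (hμ : μ ∈ Metric.ball z (‖(r : ℂ) - z‖ - R)) : R ≤ ‖(r : ℂ) - μ‖ := by
    rw [mem_ball_iff_norm] at hμ
    have := norm_sub_le_norm_sub_add_norm_sub (r : ℂ) μ z
    linarith
  obtain ⟨hres, hbound⟩ := exists_resolvent_bound hα_nonneg hα_mono hα_diff hR hB
  rw [waelbroeckSpectrum, Set.notMem_compl_iff]
  refine ⟨_, sub_pos.2 hRz, fun μ hμ => hres μ (hball μ hμ), ?_⟩
  refine UniformEquicontinuous.equicontinuous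
    (((withSeminorms α).uniformEquicontinuous_iff_exists_continuous_seminorm
      fun μ : Metric.ball z (‖(r : ℂ) - z‖ - R) =>
        (resolvent B (μ : ℂ)).toLinearMap).2 fun k => ?_)
  obtain ⟨C, hC0, hC⟩ := hbound k
  lift C to NNReal using hC0
  refine ⟨C • seminorms α k, ((withSeminorms α).continuous_seminorm k).const_smul C, fun μ y => ?_⟩
  exact hC μ (hball μ μ.2) y

end PowerSeriesSpace

/-! ### Inclusions between the spectra, and the conclusion. -/

section SpectrumInclusions

variable {X : Type*} [AddCommGroup X] [Module ℂ X] [UniformSpace X] [IsUniformAddGroup X]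
  [ContinuousSMul ℂ X]

theorem spectrum_subset_waelbroeckSpectrum (T : X →L[ℂ] X) :
    spectrum ℂ T ⊆ waelbroeckSpectrum T := by
  rintro z hz ⟨δ, hδ, hsub, -⟩
  exact hz (hsub (Metric.mem_ball_self hδ))

theorem range_sub_smul_eq_univ {T : X →L[ℂ] X} {z : ℂ} (hz : z ∉ spectrum ℂ T) :
    Set.range (T - z • ContinuousLinearMap.id ℂ X) = Set.univ := by
  obtain ⟨u, hu⟩ : IsUnit (algebraMap ℂ (X →L[ℂ] X) z - T) := not_not.1 hz
  refine Set.eq_univ_of_forall fun y => ⟨-((↑u⁻¹ : X →L[ℂ] X) y), ?_⟩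
  have h1 : T - z • ContinuousLinearMap.id ℂ X = -(u : X →L[ℂ] X) := by
    rw [hu, neg_sub, Algebra.algebraMap_eq_smul_one]
    rfl
  have h2 : (u : X →L[ℂ] X) ((↑u⁻¹ : X →L[ℂ] X) y) = y :=
    congrArg (fun S : X →L[ℂ] X => S y) u.mul_inv
  rw [h1, neg_apply, map_neg, neg_neg, h2]

theorem residualSpectrum_subset_spectrum (T : X →L[ℂ] X) :
    residualSpectrum T ⊆ spectrum ℂ T := by
  intro z hz
  by_contra h
  exact hz.2 (by rw [range_sub_smul_eq_univ h, closure_univ])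

/-- If all the spectra lie between the residual spectrum and the Waelbroeck spectrum and these
two agree, then everything is determined. -/
theorem spectra_eq_of_subset {T : X →L[ℂ] X} {S : Set ℂ} (hp : pointSpectrum T = ∅)
    (hr : S ⊆ residualSpectrum T) (hw : waelbroeckSpectrum T ⊆ S) :
    pointSpectrum T = ∅ ∧ continuousSpectrum T = ∅ ∧ waelbroeckSpectrum T = S ∧
      spectrum ℂ T = S ∧ residualSpectrum T = S := by
  have h1 := residualSpectrum_subset_spectrum T
  have h2 := spectrum_subset_waelbroeckSpectrum T
  have hS : spectrum ℂ T = S := (h2.trans hw).antisymm (hr.trans h1)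
  refine ⟨hp, Set.eq_empty_of_forall_notMem fun z hz => ?_, hw.antisymm ((hr.trans h1).trans h2),
    hS, (h1.trans (h2.trans hw)).antisymm hr⟩
  by_cases h : z ∈ spectrum ℂ T
  · exact (hr (hS ▸ h)).2 hz.2.2
  · exact hz.2.1 (range_sub_smul_eq_univ h)

end SpectrumInclusions

theorem theorem4p4 (α : ℕ → ℝ) (l : ℝ) (hα_nonneg : ∀ n, 0 ≤ α n) (hα_mono : Monotone α)
    (hα_top : Filter.Tendsto α Filter.atTop Filter.atTop) (hl : 0 ≤ l)
    (hα_diff : Filter.Tendsto (fun n => α (n + 1) - α n) Filter.atTop (nhds l))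
    (hα_log : ∃ c : ℝ, 0 < c ∧ ∀ n : ℕ, c * Real.log ((n : ℝ) + 1) ≤ α n)
    (r s : ℝ) (hr : r ≠ 0) (hs : s ≠ 0) :
    ∃ B : PowerSeriesSpace α →L[ℂ] PowerSeriesSpace α,
      (∀ x, PowerSeriesSpace.toSeq α (B x) = differenceOp r s (PowerSeriesSpace.toSeq α x)) ∧
      (l = 0 →
        pointSpectrum B = ∅ ∧
        continuousSpectrum B = ∅ ∧
        waelbroeckSpectrum B = Metric.closedBall (r : ℂ) |s| ∧
        spectrum ℂ B = Metric.closedBall (r : ℂ) |s| ∧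
        residualSpectrum B = Metric.closedBall (r : ℂ) |s|) ∧
      (0 < l →
        pointSpectrum B = ∅ ∧
        continuousSpectrum B = ∅ ∧
        waelbroeckSpectrum B = Set.univ ∧
        spectrum ℂ B = Set.univ ∧
        residualSpectrum B = Set.univ) := by
  -- Convergent increments are bounded, which is all that continuity of B needs.
  obtain ⟨D, hD⟩ := hα_diff.bddAbove_range
  obtain ⟨B, hB⟩ := PowerSeriesSpace.exists_continuousLinearMap_differenceOp r s
    fun n => hD (Set.mem_range_self n)
  have hinj := PowerSeriesSpace.eq_zero_of_sub_smul_eq_zero hs hB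
  have hp : pointSpectrum B = ∅ :=
    Set.eq_empty_of_forall_notMem fun z ⟨x, hx, hx0⟩ => hx0 (hinj z x hx)
  have hres (z : ℂ) (hz : z ∈ Metric.closedBall (r : ℂ) |s| ∨ 0 < l) : z ∈ residualSpectrum B :=
    ⟨hinj z, PowerSeriesSpace.closure_range_sub_smul_ne_univ hα_diff hα_log hs hB hz⟩
  refine ⟨B, hB, fun h0 => ?_, fun hpos => ?_⟩
  · subst h0
    exact spectra_eq_of_subset hp (fun z hz => hres z (Or.inl hz))
      (PowerSeriesSpace.waelbroeckSpectrum_subset_closedBall hα_nonneg hα_mono hα_diff hB)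
  · exact spectra_eq_of_subset hp (fun z _ => hres z (Or.inr hpos)) (Set.subset_univ _)
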